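/- Let $G$ be a finite, non-empty simple graph without isolated vertices, with vertex set $V_G$, edge set $E_G$ and $b_0(G)$ connected components, and let $K$ be any field. Let $\theta\colon K[t_e : e\in E_G]\to K[x_i : i\in V_G]$ be the homomorphism of $K$-algebras with $\theta(t_e)=x_ix_j$ for every edge $e=\{i,j\}$, and let $$I(X_G)=\theta^{-1}\bigl((x_i^2-x_j^2 : i,j\in V_G)\bigr)\subseteq K[E_G]=K[t_e : e\in E_G].$$ Then $I(X_G)$ is a homogeneous ideal, and its degree (that is, the multiplicity of the graded ring $K[E_G]/I(X_G)$: $(\deg P)!$ times the leading coefficient of its Hilbert polynomial $P$ if $P\neq 0$, and $\dim_K K[E_G]/I(X_G)$ if $P=0$) equals $2^{|V_G|-b_0(G)}$ if $G$ is non-bipartite, and $2^{|V_G|-b_0(G)-1}$ if $G$ is bipartite. -/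

import Mathlib

open MvPolynomial

namespace GraphIdeal

noncomputable section

/-- The Hilbert function of `K[σ] / I`: the `K`-dimension of the image of the forms of degree `n`
in the quotient (for homogeneous `I`, this is the degree `n` component of the quotient). -/
def hilbertFunction {σ K : Type*} [Field K] (I : Ideal (MvPolynomial σ K)) (n : ℕ) : ℕ :=
  Module.finrank K
    ((homogeneousSubmodule σ K n).map (Ideal.Quotient.mkₐ K I).toLinearMap)

/-- `P` is the Hilbert polynomial of `K[σ] / I`: it agrees with the Hilbert function in all
large degrees. Such a `P` is unique if it exists. -/
def IsHilbertPolynomial {σ K : Type*} [Field K] (I : Ideal (MvPolynomial σ K))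
    (P : Polynomial ℚ) : Prop :=
  ∃ N : ℕ, ∀ n : ℕ, N ≤ n → (hilbertFunction I n : ℚ) = P.eval (n : ℚ)

/-- The homogeneous ideal `I` has degree (multiplicity) `e`: `K[σ] / I` has a Hilbert polynomial
`P`, and `e` is `(deg P)!` times the leading coefficient of `P` if `P ≠ 0`, and the length
`dim_K (K[σ] / I)` if `P = 0`. -/
def HasDegree {σ K : Type*} [Field K] (I : Ideal (MvPolynomial σ K)) (e : ℕ) : Prop :=
  (∀ f ∈ I, ∀ n : ℕ, homogeneousComponent n f ∈ I) ∧
    ∃ P : Polynomial ℚ, IsHilbertPolynomial I P ∧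
      (P ≠ 0 → (e : ℚ) = (P.natDegree.factorial : ℚ) * P.leadingCoeff) ∧
      (P = 0 → e = Module.finrank K (MvPolynomial σ K ⧸ I))

variable {V : Type*} (K : Type*) [Field K] (G : SimpleGraph V)

/-- The homomorphism `θ : K[E_G] → K[V_G]` with `t_e ↦ x_i x_j` for `e = {i, j}`. -/
def theta : MvPolynomial G.edgeSet K →ₐ[K] MvPolynomial V K :=
  aeval fun e => (Sym2.map (fun i => (X i : MvPolynomial V K)) (e : Sym2 V)).mul

/-- The ideal `(x_i² - x_j² : i, j ∈ V)` of `K[V]`. -/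
def squaresIdeal (V K : Type*) [Field K] : Ideal (MvPolynomial V K) :=
  Ideal.span {f | ∃ i j : V, f = X i ^ 2 - X j ^ 2}

/-- The ideal `I(X_G) = θ⁻¹(x_i² - x_j² : i, j ∈ V_G)` of `K[E_G]`. -/
def idealXG : Ideal (MvPolynomial G.edgeSet K) :=
  (squaresIdeal V K).comap (theta K G)

end

end GraphIdeal

/-!
Modulo `x_i ^ 2 = x_j ^ 2`, a monomial in the `x_i` is determined by its degree and the parities of
its exponents, so `I(X_G)` is the toric ideal of the vectors `(2, v_e)` in `ℕ × 𝔽₂^V`, where `v_e`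
is the column of the edge `e` in the incidence matrix. Its Hilbert function in degree `n` is the
size of the `n`-fold sumset of `S = {v_e}`, which for large `n` is a translate of the subgroup
generated by `S - S`, that is, of the direction of the affine span of `S`. The incidence matrix has
rank `|V| - b₀(G)` over `𝔽₂`, as its left kernel consists of the functions constant on components.
The direction of the affine span is the whole linear span of `S` unless some linear functional is
`1` on all of `S`, when it has codimension one in it; such a functional is a 2-colouring of `G`.
-/

namespace GraphIdeal

section Sumset

open scoped Pointwise

lemma exists_forall_nsmul_eq_closure {A : Type*} [AddGroup A] [Finite A] {T : Set A}
    (h0 : 0 ∈ T) : ∃ N : ℕ, ∀ n, N ≤ n → n • T = (AddSubgroup.closure T : Set A) := by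
  have hmono : Monotone fun n : ℕ => n • T := Set.nsmul_right_monotone h0
  obtain ⟨N, hN⟩ := WellFoundedGT.monotone_chain_condition ⟨_, hmono⟩
  have mem_of_mem_nsmul {m : ℕ} {x : A} (hx : x ∈ m • T) : x ∈ N • T := by
    change x ∈ (fun n : ℕ => n • T) N
    rcases le_total m N with hm | hm
    · exact hmono hm hx
    · exact (hN m hm).symm.subset hx
  suffices h : N • T = (AddSubgroup.closure T : Set A) from
    ⟨N, fun n hn => (hN n hn).symm.trans h⟩
  refine (AddSubmonoid.nsmul_subset (S := (AddSubgroup.closure T).toAddSubmonoid)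
    AddSubgroup.subset_closure).antisymm fun x hx => ?_
  rw [SetLike.mem_coe, AddSubgroup.closure_toAddSubmonoid_of_finite] at hx
  induction hx using AddSubmonoid.closure_induction with
  | mem x hx => exact mem_of_mem_nsmul (m := 1) (by rwa [one_nsmul])
  | zero => exact mem_of_mem_nsmul (m := 0) (by simp)
  | add x y _ _ hx hy =>
    exact mem_of_mem_nsmul (m := N + N) (by rw [add_nsmul]; exact Set.add_mem_add hx hy)

lemma closure_sub_singleton {A : Type*} [AddGroup A] {S : Set A} {s : A} (hs : s ∈ S) :
    AddSubgroup.closure (S - {s}) = AddSubgroup.closure (S - S) := by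
  refine le_antisymm (AddSubgroup.closure_mono
    (Set.sub_subset_sub_left (Set.singleton_subset_iff.mpr hs))) ?_
  rw [AddSubgroup.closure_le]
  rintro _ ⟨a, ha, b, hb, rfl⟩
  have hmem {c : A} (hc : c ∈ S) : c - s ∈ AddSubgroup.closure (S - {s}) :=
    AddSubgroup.subset_closure (Set.sub_mem_sub hc rfl)
  simpa using sub_mem (hmem ha) (hmem hb)

lemma exists_forall_ncard_nsmul_eq {A : Type*} [AddCommGroup A] [Finite A] {S : Set A}
    (hS : S.Nonempty) :
    ∃ N : ℕ, ∀ n, N ≤ n → (n • S).ncard = Nat.card (AddSubgroup.closure (S - S)) := by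
  obtain ⟨s, hs⟩ := hS
  have h0 : (0 : A) ∈ S - {s} := ⟨s, hs, s, rfl, sub_self s⟩
  obtain ⟨N, hN⟩ := exists_forall_nsmul_eq_closure h0
  refine ⟨N, fun n hn => ?_⟩
  have htranslate : n • S = (· + n • s) '' (n • (S - {s})) := by
    rw [← Set.add_singleton, ← Set.nsmul_singleton, ← nsmul_add, sub_eq_add_neg, add_assoc]
    simp
  rw [htranslate, Set.ncard_image_of_injective _ (add_left_injective _), hN n hn,
    closure_sub_singleton hs]
  rfl

end Sumset

section MonomialMap

open scoped Pointwise

variable {σ M R : Type*} [AddCommMonoid M] [CommSemiring R]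

/-- The `R`-algebra map `R[σ] → R[M]` sending the variable `i` to the monomial of exponent `g i`.
Its kernel is the toric ideal of the configuration `g`, where `M` may have torsion. -/
noncomputable def monomialMap (R : Type*) [CommSemiring R] (g : σ → M) :
    MvPolynomial σ R →ₐ[R] AddMonoidAlgebra R M :=
  aeval fun i => AddMonoidAlgebra.single (g i) 1

lemma monomialMap_monomial (g : σ → M) (a : σ →₀ ℕ) (c : R) :
    monomialMap R g (monomial a c) =
      AddMonoidAlgebra.single (Finsupp.linearCombination ℕ g a) c := by
  simp [monomialMap, aeval_monomial, AddMonoidAlgebra.single_pow, Finsupp.prod,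
    AddMonoidAlgebra.prod_single, AddMonoidAlgebra.single_mul_single,
    Finsupp.linearCombination_apply, Finsupp.sum]

lemma map_eq_zero_of_mem_ker_monomialMap {N : Type*} [AddCommMonoid N] [Module R N] {g : σ → M}
    {ψ : MvPolynomial σ R →ₗ[R] N}
    (hψ : ∀ a b, Finsupp.linearCombination ℕ g a = Finsupp.linearCombination ℕ g b →
      ψ (monomial a 1) = ψ (monomial b 1))
    {f : MvPolynomial σ R} (hf : f ∈ RingHom.ker (monomialMap R g)) : ψ f = 0 := by
  let rep := Function.invFun (Finsupp.linearCombination ℕ g)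
  let ψ' : AddMonoidAlgebra R M →ₗ[R] N :=
    (AddMonoidAlgebra.basis M R).constr R fun p => ψ (monomial (rep p) 1)
  have hfactor : ψ' ∘ₗ (monomialMap R g).toLinearMap = ψ := by
    refine (basisMonomials σ R).ext fun a => ?_
    have hψ' (p : M) : ψ' (AddMonoidAlgebra.single p 1) = ψ (monomial (rep p) 1) :=
      (AddMonoidAlgebra.basis M R).constr_basis R _ p
    simp only [coe_basisMonomials, LinearMap.comp_apply, AlgHom.toLinearMap_apply,
      monomialMap_monomial, hψ']
    exact hψ _ _ (Function.invFun_eq ⟨a, rfl⟩)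
  rw [← hfactor, LinearMap.comp_apply, AlgHom.toLinearMap_apply, RingHom.mem_ker.mp hf, map_zero]

lemma homogeneousComponent_mem_ker_monomialMap {g : σ → M}
    (hg : ∀ a b, Finsupp.linearCombination ℕ g a = Finsupp.linearCombination ℕ g b →
      a.degree = b.degree)
    {f : MvPolynomial σ R} (hf : f ∈ RingHom.ker (monomialMap R g)) (n : ℕ) :
    homogeneousComponent n f ∈ RingHom.ker (monomialMap R g) := by
  refine map_eq_zero_of_mem_ker_monomialMap
    (ψ := (monomialMap R g).toLinearMap ∘ₗ homogeneousComponent n) (fun a b hab => ?_) hf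
  have hcomp (a : σ →₀ ℕ) : homogeneousComponent n (monomial a (1 : R)) =
      if a.degree = n then monomial a 1 else 0 := by
    simp only [homogeneousComponent_of_mem (isHomogeneous_monomial (1 : R) rfl), eq_comm]
  simp only [LinearMap.comp_apply, AlgHom.toLinearMap_apply, hcomp, hg a b hab]
  split_ifs
  · simp only [monomialMap_monomial, hab]
  · rfl

lemma image_linearCombination_degree_eq (g : σ → M) (n : ℕ) :
    Finsupp.linearCombination ℕ g '' {a | a.degree = n} = n • Set.range g := by
  have hdegree : {a : σ →₀ ℕ | a.degree = n} = n • Set.range fun i => Finsupp.single i 1 := by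
    rw [← Set.image_univ, Finsupp.nsmul_single_one_image]
    simp
  rw [hdegree, Set.image_nsmul, ← Set.range_comp]
  simp [Function.comp_def]

lemma map_homogeneousSubmodule_monomialMap (g : σ → M) (n : ℕ) :
    (homogeneousSubmodule σ R n).map (monomialMap R g).toLinearMap =
      Submodule.span R ((AddMonoidAlgebra.single · (1 : R)) '' (n • Set.range g)) := by
  have hspan : homogeneousSubmodule σ R n =
      Submodule.span R ((monomial · (1 : R)) '' {a | a.degree = n}) := by
    rw [homogeneousSubmodule_eq_finsupp_supported]
    exact AddMonoidAlgebra.supported_eq_span_single ..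
  rw [hspan, Submodule.map_span, ← image_linearCombination_degree_eq, Set.image_image,
    Set.image_image]
  simp only [AlgHom.toLinearMap_apply, monomialMap_monomial]

variable {K : Type*} [Field K]

lemma hilbertFunction_ker {σ B : Type*} [CommRing B] [Algebra K B]
    (φ : MvPolynomial σ K →ₐ[K] B) (n : ℕ) :
    hilbertFunction (RingHom.ker φ) n =
      Module.finrank K ((homogeneousSubmodule σ K n).map φ.toLinearMap) := by
  have hfactor : φ.toLinearMap = (Ideal.kerLiftAlg φ).toLinearMap ∘ₗ
      (Ideal.Quotient.mkₐ K (RingHom.ker φ)).toLinearMap := rfl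
  rw [hfactor, Submodule.map_comp]
  exact (Submodule.equivMapOfInjective _ (Ideal.kerLiftAlg_injective φ) _).finrank_eq

lemma hilbertFunction_ker_monomialMap (g : σ → M) (n : ℕ) :
    hilbertFunction (RingHom.ker (monomialMap K g)) n = (n • Set.range g).ncard := by
  have hli : LinearIndependent K fun p : ↥(n • Set.range g) =>
      AddMonoidAlgebra.single (p : M) (1 : K) :=
    (AddMonoidAlgebra.basis M K).linearIndependent.comp _ Subtype.val_injective
  rw [hilbertFunction_ker, map_homogeneousSubmodule_monomialMap, Set.image_eq_range,
    Module.finrank_eq_nat_card_basis (Module.Basis.span hli)]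
  rfl

lemma linearCombination_prodMk_const {N : Type*} [AddCommMonoid N] (d : N) (g : σ → M)
    (a : σ →₀ ℕ) :
    Finsupp.linearCombination ℕ (fun i => (d, g i)) a =
      (a.degree • d, Finsupp.linearCombination ℕ g a) := by
  induction a using Finsupp.induction_linear with
  | zero => simp [Prod.zero_eq_mk]
  | add a b ha hb => simp [ha, hb, add_smul]
  | single i k => simp

lemma HasDegree.of_hilbertFunction_eventually_const {I : Ideal (MvPolynomial σ K)} {e N : ℕ}
    (hI : ∀ f ∈ I, ∀ n, homogeneousComponent n f ∈ I) (he : e ≠ 0)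
    (h : ∀ n, N ≤ n → hilbertFunction I n = e) : HasDegree I e := by
  refine ⟨hI, Polynomial.C (e : ℚ), ⟨N, fun n hn => ?_⟩, fun _ => ?_, fun h0 => ?_⟩
  · rw [h n hn, Polynomial.eval_C]
  · simp only [Polynomial.natDegree_C, Polynomial.leadingCoeff_C, Nat.factorial_zero, Nat.cast_one,
      one_mul]
  · exact absurd h0 (by simpa using he)

theorem hasDegree_ker_monomialMap {A : Type*} [AddCommGroup A] [Finite A] [Nonempty σ] {d : ℕ}
    (hd : d ≠ 0) (g : σ → A) :
    HasDegree (RingHom.ker (monomialMap K fun i => (d, g i)))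
      (Nat.card (AddSubgroup.closure (Set.range g - Set.range g))) := by
  have hdeg (a b : σ →₀ ℕ) (hab : Finsupp.linearCombination ℕ (fun i => (d, g i)) a =
      Finsupp.linearCombination ℕ (fun i => (d, g i)) b) : a.degree = b.degree := by
    simp only [linearCombination_prodMk_const, smul_eq_mul, Prod.mk.injEq] at hab
    exact Nat.eq_of_mul_eq_mul_right (Nat.pos_of_ne_zero hd) hab.1
  have hprod (n : ℕ) :
      n • Set.range (fun i => (d, g i)) = Prod.mk (n • d) '' (n • Set.range g) := by
    rw [← image_linearCombination_degree_eq, ← image_linearCombination_degree_eq, Set.image_image]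
    exact Set.image_congr fun a (ha : a.degree = n) => by rw [linearCombination_prodMk_const, ha]
  obtain ⟨N, hN⟩ := exists_forall_ncard_nsmul_eq (Set.range_nonempty g)
  refine .of_hilbertFunction_eventually_const (N := N)
    (fun _ hf => homogeneousComponent_mem_ker_monomialMap hdeg hf) Nat.card_pos.ne' fun n hn => ?_
  rw [hilbertFunction_ker_monomialMap, hprod,
    Set.ncard_image_of_injective _ (Prod.mk_right_injective _), hN n hn]

end MonomialMap

section LinearAlgebra

open Module
open scoped Pointwise

variable {k E : Type*} [Ring k] [AddCommGroup E] [Module k E] {S : Set E}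

lemma notMem_vectorSpan_of_zero_notMem_affineSpan {s : E} (hs : s ∈ S)
    (h0 : (0 : E) ∉ affineSpan k S) : s ∉ vectorSpan k S := fun h => h0 <| by
  simpa using vadd_mem_affineSpan_of_mem_affineSpan_of_mem_vectorSpan
    (mem_affineSpan k hs) (neg_mem h)

lemma vectorSpan_eq_span_of_zero_mem (h0 : (0 : E) ∈ affineSpan k S) :
    vectorSpan k S = Submodule.span k S := by
  rw [← vectorSpan_insert_eq_vectorSpan h0,
    vectorSpan_eq_span_vsub_set_right k (Set.mem_insert (0 : E) S)]
  simp

lemma exists_dual_forall_eq_one_iff {k E : Type*} [Field k] [AddCommGroup E] [Module k E]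
    {S : Set E} :
    (∃ f : Dual k E, ∀ x ∈ S, f x = 1) ↔ (0 : E) ∉ affineSpan k S := by
  constructor
  · rintro ⟨f, hf⟩ h0
    have hle : affineSpan k S ≤ (affineSpan k {(1 : k)}).comap f.toAffineMap :=
      affineSpan_le.mpr fun x hx => by simp [hf x hx]
    simpa using hle h0
  · intro h0
    rcases S.eq_empty_or_nonempty with rfl | ⟨s, hs⟩
    · exact ⟨0, fun _ hx => absurd hx (Set.notMem_empty _)⟩
    obtain ⟨f, hfs, hker⟩ := Submodule.exists_le_ker_of_notMem
      (notMem_vectorSpan_of_zero_notMem_affineSpan hs h0)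
    refine ⟨(f s)⁻¹ • f, fun x hx => ?_⟩
    have hfx : f x = f s := by
      simpa [sub_eq_zero] using hker (vsub_mem_vectorSpan k hx hs)
    simp [hfx, hfs]

lemma finrank_span_eq_finrank_vectorSpan_add_one {k E : Type*} [DivisionRing k] [AddCommGroup E]
    [Module k E] [FiniteDimensional k E] {S : Set E} (hS : S.Nonempty)
    (h0 : (0 : E) ∉ affineSpan k S) :
    finrank k (Submodule.span k S) = finrank k (vectorSpan k S) + 1 := by
  obtain ⟨s, hs⟩ := hS
  have hspan : Submodule.span k S = vectorSpan k S ⊔ Submodule.span k {s} := by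
    refine le_antisymm (Submodule.span_le.mpr fun x hx => ?_) (sup_le ?_ ?_)
    · rw [SetLike.mem_coe, ← sub_add_cancel x s]
      exact Submodule.add_mem_sup (vsub_mem_vectorSpan k hx hs)
        (Submodule.mem_span_singleton_self s)
    · rw [vectorSpan_def, Submodule.span_le]
      rintro _ ⟨x, hx, y, hy, rfl⟩
      exact sub_mem (Submodule.subset_span hx) (Submodule.subset_span hy)
    · exact Submodule.span_mono (Set.singleton_subset_iff.mpr hs)
  rw [hspan, Submodule.finrank_sup_span_singleton
    (notMem_vectorSpan_of_zero_notMem_affineSpan hs h0)]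

lemma span_zmod_eq_toZModSubmodule_closure {n : ℕ} {A : Type*} [AddCommGroup A] [Module (ZMod n) A]
    (X : Set A) :
    Submodule.span (ZMod n) X = AddSubgroup.toZModSubmodule n (AddSubgroup.closure X) :=
  le_antisymm (Submodule.span_le.mpr AddSubgroup.subset_closure) fun _ hx =>
    (AddSubgroup.closure_le (Submodule.span (ZMod n) X).toAddSubgroup).mpr Submodule.subset_span hx

lemma natCard_closure_sub_eq_natCard_vectorSpan (n : ℕ) {A : Type*} [AddCommGroup A]
    [Module (ZMod n) A] (S : Set A) :
    Nat.card (AddSubgroup.closure (S - S)) = Nat.card (vectorSpan (ZMod n) S) := by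
  have hvsub : S -ᵥ S = S - S := rfl
  rw [vectorSpan_def, hvsub, span_zmod_eq_toZModSubmodule_closure]
  rfl

end LinearAlgebra

section Graph

open Module Matrix

variable {V : Type*} [DecidableEq V] (G : SimpleGraph V) [DecidableRel G.Adj]

/-- The vector of an edge: its column in the incidence matrix of `G`. Columns of the matrix are
indexed by all of `Sym2 V`, and those outside `G.edgeSet` vanish. -/
def edgeVector (R : Type*) [Zero R] [One R] (e : G.edgeSet) : V → R :=
  (G.incMatrix R).col e

lemma edgeVector_of_adj {R : Type*} [NonAssocSemiring R] {i j : V} (h : G.Adj i j) :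
    edgeVector G R ⟨s(i, j), h⟩ = Pi.single i 1 + Pi.single j 1 := by
  ext v
  simp only [edgeVector, Matrix.col_apply, SimpleGraph.incMatrix_apply',
    SimpleGraph.mk'_mem_incidenceSet_iff, h, true_and, Pi.add_apply, Pi.single_apply]
  have := h.ne
  grind

lemma span_range_col_incMatrix_eq_span_range_edgeVector {R : Type*} [CommSemiring R] :
    Submodule.span R (Set.range (G.incMatrix R).col) =
      Submodule.span R (Set.range (edgeVector G R)) := by
  refine le_antisymm (Submodule.span_le.mpr ?_)
    (Submodule.span_mono (Set.range_comp_subset_range Subtype.val _))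
  rintro _ ⟨e, rfl⟩
  by_cases he : e ∈ G.edgeSet
  · exact Submodule.subset_span ⟨⟨e, he⟩, rfl⟩
  · have hcol : (G.incMatrix R).col e = 0 :=
      funext fun v => G.incMatrix_of_notMem_incidenceSet fun h => he h.1
    rw [hcol]
    exact zero_mem _

lemma isBipartite_iff_exists_dual [Finite V] :
    G.IsBipartite ↔ ∃ f : Dual (ZMod 2) (V → ZMod 2),
      ∀ x ∈ Set.range (edgeVector G (ZMod 2)), f x = 1 := by
  have add_eq_one_iff : ∀ x y : ZMod 2, x + y = 1 ↔ x ≠ y := by decide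
  have := Fintype.ofFinite V
  constructor
  · rintro ⟨c⟩
    let color : V → ZMod 2 := c
    refine ⟨Fintype.linearCombination (ZMod 2) color, ?_⟩
    rintro _ ⟨⟨e, he⟩, rfl⟩
    induction e with
    | _ i j =>
      rw [edgeVector_of_adj G he, map_add, Fintype.linearCombination_apply_single,
        Fintype.linearCombination_apply_single, one_smul, one_smul, add_eq_one_iff]
      exact c.valid he
  · rintro ⟨f, hf⟩
    refine ⟨SimpleGraph.Coloring.mk (fun v => (f (Pi.single v 1) : ZMod 2)) fun {i j} hij => ?_⟩
    have hone : f (edgeVector G (ZMod 2) ⟨s(i, j), hij⟩) = 1 := hf _ ⟨⟨s(i, j), hij⟩, rfl⟩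
    rw [edgeVector_of_adj G hij, map_add] at hone
    exact (add_eq_one_iff _ _).mp hone

variable [Fintype V]

lemma mulVec_transpose_incMatrix_of_adj {R : Type*} [CommSemiring R] {i j : V} (h : G.Adj i j)
    (c : V → R) : ((G.incMatrix R)ᵀ *ᵥ c) s(i, j) = c i + c j := by
  change edgeVector G R ⟨s(i, j), h⟩ ⬝ᵥ c = _
  simp [edgeVector_of_adj G h, add_dotProduct]

lemma mulVec_transpose_incMatrix_eq_zero_iff {R : Type*} [CommRing R] [CharP R 2] {c : V → R} :
    (G.incMatrix R)ᵀ *ᵥ c = 0 ↔ ∀ i j, G.Adj i j → c i = c j := by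
  constructor
  · intro h i j hij
    rw [← CharTwo.add_eq_zero, ← mulVec_transpose_incMatrix_of_adj G hij, h, Pi.zero_apply]
  · intro h
    ext e
    by_cases he : e ∈ G.edgeSet
    · induction e with
      | _ i j =>
        rw [mulVec_transpose_incMatrix_of_adj G he, h i j he, CharTwo.add_self_eq_zero,
          Pi.zero_apply]
    · have hcol (v : V) : (G.incMatrix R) v e = 0 :=
        G.incMatrix_of_notMem_incidenceSet fun h => he h.1
      simp [mulVec, dotProduct, hcol]

lemma ker_mulVecLin_transpose_incMatrix (R : Type*) [CommRing R] [CharP R 2] :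
    LinearMap.ker (G.incMatrix R)ᵀ.mulVecLin =
      LinearMap.range (LinearMap.funLeft R R G.connectedComponentMk) := by
  ext c
  rw [LinearMap.mem_ker, mulVecLin_apply, mulVec_transpose_incMatrix_eq_zero_iff]
  constructor
  · intro h
    have hwalk (i j : V) (p : G.Walk i j) : c i = c j := by
      induction p with
      | nil => rfl
      | cons hij _ ih => exact (h _ _ hij).trans ih
    exact ⟨SimpleGraph.ConnectedComponent.lift c fun i j p _ => hwalk i j p, rfl⟩
  · rintro ⟨b, rfl⟩ i j hij
    exact congrArg b (SimpleGraph.ConnectedComponent.sound hij.reachable)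

theorem rank_incMatrix_add_card_connectedComponent (F : Type*) [Field F] [CharP F 2] :
    (G.incMatrix F).rank + Nat.card G.ConnectedComponent = Fintype.card V := by
  have := Fintype.ofFinite G.ConnectedComponent
  have hker : finrank F (LinearMap.ker (G.incMatrix F)ᵀ.mulVecLin) =
      Nat.card G.ConnectedComponent := by
    rw [ker_mulVecLin_transpose_incMatrix, LinearMap.finrank_range_of_inj
      (LinearMap.funLeft_injective_of_surjective F F G.connectedComponentMk Quot.mk_surjective),
      finrank_fintype_fun_eq_card, Nat.card_eq_fintype_card]
  rw [← rank_transpose, ← hker, Matrix.rank, LinearMap.finrank_range_add_finrank_ker,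
    finrank_fintype_fun_eq_card]

end Graph

section Squares

lemma prod_pow_eq_prod_pow_of_sq_eq {ι R : Type*} [CommMonoid R] {y : ι → R}
    (hy : ∀ i j, y i ^ 2 = y j ^ 2) {a b : ι →₀ ℕ} (hparity : ∀ i, a i % 2 = b i % 2)
    (hdegree : a.degree = b.degree) :
    (a.prod fun i n => y i ^ n) = b.prod fun i n => y i ^ n := by
  rcases isEmpty_or_nonempty ι with _ | ⟨⟨v⟩⟩
  · rw [Subsingleton.elim a b]
  let rem (c : ι →₀ ℕ) : ι →₀ ℕ := c.mapRange (· % 2) rfl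
  let quo (c : ι →₀ ℕ) : ι →₀ ℕ := c.mapRange (· / 2) rfl
  have rem_add_quo (c : ι →₀ ℕ) : rem c + (quo c + quo c) = c :=
    Finsupp.ext fun i => by simp [rem, quo, ← two_mul, Nat.mod_add_div]
  have prod_eq (c : ι →₀ ℕ) :
      (c.prod fun i n => y i ^ n) =
        ((rem c).prod fun i n => y i ^ n) * (y v ^ 2) ^ (quo c).degree := by
    have prod_add (c d : ι →₀ ℕ) : ((c + d).prod fun i n => y i ^ n) =
        (c.prod fun i n => y i ^ n) * d.prod fun i n => y i ^ n :=
      Finsupp.prod_add_index' (fun i => pow_zero (y i)) fun i => pow_add (y i)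
    conv_lhs => rw [← rem_add_quo c, prod_add, prod_add, ← Finsupp.prod_mul]
    congr 1
    rw [Finsupp.degree_apply, ← Finset.prod_pow_eq_pow_sum]
    exact Finset.prod_congr rfl fun i _ => by
      simp only [← pow_add, ← two_mul, pow_mul, hy i v]
  have hrem : rem a = rem b := Finsupp.ext hparity
  have hquo : (quo a).degree = (quo b).degree := by
    rw [← rem_add_quo a, ← rem_add_quo b, map_add, map_add, map_add, map_add, hrem] at hdegree
    omega
  rw [prod_eq a, prod_eq b, hrem, hquo]

variable {V : Type*} [DecidableEq V] (K : Type*) [Field K]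

lemma linearCombination_single_one (R : Type*) [Semiring R] (a : V →₀ ℕ) :
    Finsupp.linearCombination ℕ (fun i => (Pi.single i 1 : V → R)) a = fun i => (a i : R) := by
  induction a using Finsupp.induction_linear with
  | zero => ext; simp
  | add a b ha hb => ext; simp [ha, hb]
  | single i k => ext j; simp [Finsupp.single_apply, Pi.single_apply, eq_comm]

theorem squaresIdeal_eq_ker_monomialMap :
    squaresIdeal V K =
      RingHom.ker (monomialMap K fun i : V => ((1 : ℕ), (Pi.single i 1 : V → ZMod 2))) := by
  refine le_antisymm (Ideal.span_le.mpr ?_) fun f hf => ?_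
  · rintro _ ⟨i, j, rfl⟩
    have htwo (v : V) : 2 • (Pi.single v 1 : V → ZMod 2) = 0 := by
      rw [← Pi.single_smul, nsmul_one, CharP.cast_eq_zero, Pi.single_zero]
    simp [monomialMap, AddMonoidAlgebra.single_pow, htwo]
  · rw [← Ideal.Quotient.eq_zero_iff_mem]
    refine map_eq_zero_of_mem_ker_monomialMap
      (ψ := (Ideal.Quotient.mkₐ K (squaresIdeal V K)).toLinearMap) (fun a b hab => ?_) hf
    simp only [linearCombination_prodMk_const, linearCombination_single_one, smul_eq_mul,
      mul_one, Prod.mk.injEq] at hab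
    have hmonomial (c : V →₀ ℕ) : Ideal.Quotient.mkₐ K (squaresIdeal V K) (monomial c 1) =
        c.prod fun i n => Ideal.Quotient.mkₐ K (squaresIdeal V K) (X i) ^ n := by
      rw [monomial_eq, C_1, one_mul, map_finsuppProd]
      simp only [map_pow]
    rw [AlgHom.toLinearMap_apply, AlgHom.toLinearMap_apply, hmonomial, hmonomial]
    refine prod_pow_eq_prod_pow_of_sq_eq (fun i j => ?_) (fun i => ?_) hab.1
    · rw [← map_pow, ← map_pow]
      exact Ideal.Quotient.eq.mpr (Ideal.subset_span ⟨i, j, rfl⟩)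
    · exact (ZMod.natCast_eq_natCast_iff' _ _ _).mp (congrFun hab.2 i)

theorem idealXG_eq_ker_monomialMap (G : SimpleGraph V) [DecidableRel G.Adj] :
    idealXG K G =
      RingHom.ker (monomialMap K fun e => ((2 : ℕ), edgeVector G (ZMod 2) e)) := by
  have hcomp : (monomialMap K fun i : V => ((1 : ℕ), (Pi.single i 1 : V → ZMod 2))).comp
      (theta K G) = monomialMap K fun e => (2, edgeVector G (ZMod 2) e) := by
    refine algHom_ext fun ⟨e, he⟩ => ?_
    induction e with
    | _ i j =>
      simp [theta, monomialMap, edgeVector_of_adj G he, AddMonoidAlgebra.single_mul_single]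
  rw [idealXG, squaresIdeal_eq_ker_monomialMap, ← hcomp]
  rfl

end Squares

section Degree

open Module

variable {V : Type*} [DecidableEq V] (K : Type*) [Field K] (G : SimpleGraph V)
  [DecidableRel G.Adj]

theorem hasDegree_idealXG [Finite V] (hG : G ≠ ⊥) :
    HasDegree (idealXG K G) (2 ^ finrank (ZMod 2)
      (vectorSpan (ZMod 2) (Set.range (edgeVector G (ZMod 2))))) := by
  have : Nonempty G.edgeSet := (SimpleGraph.edgeSet_nonempty.mpr hG).to_subtype
  have hcard := natCard_closure_sub_eq_natCard_vectorSpan 2 (Set.range (edgeVector G (ZMod 2)))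
  rw [Module.natCard_eq_pow_finrank (K := ZMod 2) (V := vectorSpan _ _), Nat.card_zmod] at hcard
  rw [idealXG_eq_ker_monomialMap, ← hcard]
  exact hasDegree_ker_monomialMap two_ne_zero _

lemma finrank_span_range_edgeVector_add_card_connectedComponent [Fintype V] (F : Type*) [Field F]
    [CharP F 2] :
    finrank F (Submodule.span F (Set.range (edgeVector G F))) +
      Nat.card G.ConnectedComponent = Fintype.card V := by
  rw [← span_range_col_incMatrix_eq_span_range_edgeVector, ← Matrix.rank_eq_finrank_span_cols,
    rank_incMatrix_add_card_connectedComponent]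

end Degree

end GraphIdeal

theorem mainTheorem6_general {V : Type*} [Fintype V] (K : Type*) [Field K] (G : SimpleGraph V)
    (hG : G ≠ ⊥) :
    (¬ G.IsBipartite →
      GraphIdeal.HasDegree (GraphIdeal.idealXG K G)
        (2 ^ (Fintype.card V - Nat.card G.ConnectedComponent))) ∧
    (G.IsBipartite →
      GraphIdeal.HasDegree (GraphIdeal.idealXG K G)
        (2 ^ (Fintype.card V - Nat.card G.ConnectedComponent - 1))) := by
  classical
  have hrank :=
    GraphIdeal.finrank_span_range_edgeVector_add_card_connectedComponent G (ZMod 2)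
  rw [GraphIdeal.isBipartite_iff_exists_dual, GraphIdeal.exists_dual_forall_eq_one_iff, not_not]
  refine ⟨fun h0 => ?_, fun h0 => ?_⟩
  · have hspan := GraphIdeal.vectorSpan_eq_span_of_zero_mem h0
    convert GraphIdeal.hasDegree_idealXG K G hG using 2
    rw [hspan]
    omega
  · have : Nonempty G.edgeSet := (SimpleGraph.edgeSet_nonempty.mpr hG).to_subtype
    have hspan :=
      GraphIdeal.finrank_span_eq_finrank_vectorSpan_add_one (Set.range_nonempty _) h0
    convert GraphIdeal.hasDegree_idealXG K G hG using 2
    omega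

theorem mainTheorem6 {V : Type*} [Fintype V] [Nonempty V] (K : Type*) [Field K]
    (G : SimpleGraph V) (hG : ∀ v : V, ∃ w : V, G.Adj v w) :
    (¬ G.IsBipartite →
      GraphIdeal.HasDegree (GraphIdeal.idealXG K G)
        (2 ^ (Fintype.card V - Nat.card G.ConnectedComponent))) ∧
    (G.IsBipartite →
      GraphIdeal.HasDegree (GraphIdeal.idealXG K G)
        (2 ^ (Fintype.card V - Nat.card G.ConnectedComponent - 1))) := by
  obtain ⟨w, hw⟩ := hG (Classical.arbitrary V)
  exact mainTheorem6_general K G (SimpleGraph.ne_bot_iff_exists_adj.mpr ⟨_, w, hw⟩)
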